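/- Let $\gamma$ be the standard Gaussian probability measure on $\mathbb R$, let $\mu_n=\gamma^{\otimes n}$ be the standard Gaussian measure on $\mathbb R^n$, and let $\mu_{\infty}=\gamma\otimes\gamma\otimes\cdots$ on $\mathbb R^\infty=\mathbb R^{\{1,2,\dots\}}$; all $L^2$-spaces are complex. For a measurable transformation $A$ of a measure space $(X,\mu)$ with $\mu\circ A^{-1}\ll\mu$ (a nonsingular transformation), the composition operator $C_A$ in $L^2(\mu)$ is given by $C_Af=f\circ A$ on the domain $\{f\in L^2(\mu): f\circ A\in L^2(\mu)\}$. Let $(a_{ij})_{i,j\ge 1}$ be a real matrix such that for every $j$ there is $K$ with $a_{j,k}=0$ for all $k\ge K$, and let $A:\mathbb R^\infty\to\mathbb R^\infty$ be the transformation it induces, $(Ax)_i=\sum_{j}a_{ij}x_j$. For $n\ge1$ let $A_n$ be the linear transformation of $\mathbb R^n$ induced by $(a_{ij})_{i,j=1}^n$. Suppose that there is $\varepsilon>0$ with $|\det A_n|\ge\varepsilon$ for all $n\ge1$, and that $\|A_n\|\le1$ for all $n\ge1$, where $\|\cdot\|$ is the operator norm for the Euclidean norm on $\mathbb R^n$.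 Then $A$ is nonsingular with respect to $\mu_\infty$, and $C_A$ is an everywhere defined bounded operator on $L^2(\mu_\infty)$. Moreover, for every $n$, $A_n$ is nonsingular with respect to $\mu_n$, $C_{A_n}$ is an everywhere defined bounded operator on $L^2(\mu_n)$, and there is exactly one bounded operator $C_{A_n}\otimes I_n$ on $L^2(\mu_\infty)\simeq L^2(\mu_n)\otimes L^2(\mu_\infty)$ with $$(C_{A_n}\otimes I_n)(f\otimes g)=(C_{A_n}f)\otimes g\qquad (f\in L^2(\mu_n),\ g\in L^2(\mu_\infty)),$$ where $(f\otimes g)(x)=f(x_1,\dots,x_n)\,g(x_{n+1},x_{n+2},\dots)$. Finally, $C_A$ is the limit of $(C_{A_n}\otimes I_n)_{n\ge1}$ in the strong operator topology: $\|(C_{A_n}\otimes I_n)f-C_Af\|\to0$ for every $f\in L^2(\mu_\infty)$. -/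

import Mathlib

open MeasureTheory ProbabilityTheory Filter Topology

noncomputable section

namespace GaussComp

/-! ### Composition operators in `L²` spaces -/

section CompositionOperator

variable {X : Type*} [MeasurableSpace X] {μ : Measure X} {A : X → X}

/-- The composition operator `C_A` in `L²(μ)` induced by a nonsingular transformation `A`, that is
by a measurable map `A` with `μ ∘ A⁻¹ ≪ μ`. Its domain consists of all `f ∈ L²(μ)` such that
`f ∘ A` is in `L²(μ)`, and `C_A f = f ∘ A` on this domain. -/
def compOp (μ : Measure X) (A : X → X) (hA : Measure.QuasiMeasurePreserving A μ μ) :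
    Lp ℂ 2 μ →ₗ.[ℂ] Lp ℂ 2 μ where
  domain :=
    { carrier := {f | MemLp (f ∘ A) 2 μ}
      zero_mem' := by
        have h : ((0 : Lp ℂ 2 μ) : X → ℂ) ∘ A =ᵐ[μ] (0 : X → ℂ) ∘ A :=
          hA.ae_eq_comp (Lp.coeFn_zero ℂ 2 μ)
        exact (memLp_congr_ae h).2 MemLp.zero
      add_mem' := by
        intro f g hf hg
        have h : ((f + g : Lp ℂ 2 μ) : X → ℂ) ∘ A =ᵐ[μ] (⇑f + ⇑g) ∘ A :=
          hA.ae_eq_comp (Lp.coeFn_add f g)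
        exact (memLp_congr_ae h).2 (MemLp.add hf hg)
      smul_mem' := by
        intro c f hf
        have h : ((c • f : Lp ℂ 2 μ) : X → ℂ) ∘ A =ᵐ[μ] (c • ⇑f) ∘ A :=
          hA.ae_eq_comp (Lp.coeFn_smul c f)
        exact (memLp_congr_ae h).2 (MemLp.const_smul hf c) }
  toFun :=
    { toFun := fun f => MemLp.toLp ((f : Lp ℂ 2 μ) ∘ A) f.2
      map_add' := by
        intro f g
        have h : ((f + g : Lp ℂ 2 μ) : X → ℂ) ∘ A =ᵐ[μ] (⇑(f : Lp ℂ 2 μ) + ⇑(g : Lp ℂ 2 μ)) ∘ A :=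
          hA.ae_eq_comp (Lp.coeFn_add _ _)
        rw [← MemLp.toLp_add]
        exact MemLp.toLp_congr _ _ h
      map_smul' := by
        intro c f
        have h : ((c • f : Lp ℂ 2 μ) : X → ℂ) ∘ A =ᵐ[μ] (c • ⇑(f : Lp ℂ 2 μ)) ∘ A :=
          hA.ae_eq_comp (Lp.coeFn_smul _ _)
        rw [RingHom.id_apply, ← MemLp.toLp_const_smul]
        exact MemLp.toLp_congr _ _ h }

/-- `A` induces a well-defined, everywhere defined and bounded composition operator in `L²(μ)`,
and this operator is `C`. -/
def IsBoundedCompOp (μ : Measure X) (A : X → X) (C : Lp ℂ 2 μ →L[ℂ] Lp ℂ 2 μ) : Prop :=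
  ∃ hA : Measure.QuasiMeasurePreserving A μ μ,
    compOp μ A hA = (C : Lp ℂ 2 μ →ₗ[ℂ] Lp ℂ 2 μ).toPMap ⊤

end CompositionOperator

/-! ### Gaussian measures on `ℝⁿ` and `ℝ^∞` -/

/-- The standard gaussian measure on `ℝⁿ`. -/
abbrev gaussN (n : ℕ) : Measure (Fin n → ℝ) := Measure.pi fun _ => gaussianReal 0 1

/-- The standard gaussian measure on `ℝ^∞`: the product of countably many copies of the
standard normal distribution. -/
abbrev gaussInf : Measure (ℕ → ℝ) := Measure.infinitePi fun _ => gaussianReal 0 1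

/-- The splitting `ℝ^∞ → ℝⁿ × ℝ^∞` into the first `n` coordinates and the remaining ones. -/
def split (n : ℕ) (x : ℕ → ℝ) : (Fin n → ℝ) × (ℕ → ℝ) :=
  (fun i => x i, fun k => x (n + k))

lemma measurable_split (n : ℕ) : Measurable (split n) := by
  unfold split; fun_prop

lemma measurePreserving_split (n : ℕ) :
    MeasurePreserving (split n) gaussInf ((gaussN n).prod gaussInf) := by
  refine ⟨measurable_split n, ?_⟩
  let glue : (Fin n → ℝ) × (ℕ → ℝ) → ℕ → ℝ :=
    fun p i => if h : i < n then p.1 ⟨i, h⟩ else p.2 (i - n)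
  have hg : Measurable glue := by
    refine measurable_pi_lambda _ fun i => ?_
    by_cases h : i < n
    · simp only [glue, h, dif_pos]; fun_prop
    · simp only [glue, h, dif_neg, not_false_eq_true]; fun_prop
  have hsg : split n ∘ glue = id := by
    funext p
    ext i
    · simp [split, glue]
    · simp [split, glue]
  have key : ((gaussN n).prod gaussInf).map glue = gaussInf := by
    refine Measure.eq_infinitePi _ fun s t ht => ?_
    rw [Measure.map_apply hg (MeasurableSet.pi s.countable_toSet fun i _ => ht i)]
    have hpre : glue ⁻¹' (Set.pi s t) =
        (Set.pi Set.univ fun i : Fin n => if (i : ℕ) ∈ s then t i else Set.univ) ×ˢ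
        (Set.pi ((s.filter fun i => ¬ i < n).image fun i => i - n) fun k => t (n + k)) := by
      ext p
      simp only [Set.mem_preimage, Set.mem_pi, Set.mem_prod, Finset.mem_coe, Finset.mem_image,
        Finset.mem_filter, Set.mem_univ, true_imp_iff]
      constructor
      · intro h
        refine ⟨fun i => ?_, ?_⟩
        · by_cases hi : (i : ℕ) ∈ s
          · have := h i hi
            simpa [glue, hi] using this
          · simp [hi]
        · rintro k ⟨i, ⟨his, hin⟩, rfl⟩
          have := h i his
          have e : n + (i - n) = i := by omega
          rw [e]
          simpa [glue, hin] using this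
      · rintro ⟨h1, h2⟩ i hi
        by_cases hin : i < n
        · have := h1 ⟨i, hin⟩
          simpa [glue, hin, hi] using this
        · have := h2 (i - n) ⟨i, ⟨hi, hin⟩, rfl⟩
          have e : n + (i - n) = i := by omega
          rw [e] at this
          simpa [glue, hin] using this
    rw [hpre, Measure.prod_prod, Measure.pi_pi, Measure.infinitePi_pi _ (fun k _ => ht (n + k)),
      Finset.prod_image, ← Finset.prod_filter_mul_prod_filter_not s (fun i => i < n)]
    · congr 1
      · have h1 : ∀ i : Fin n, gaussianReal 0 1 (if (i : ℕ) ∈ s then t i else Set.univ) =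
            (fun j : ℕ => if j ∈ s then gaussianReal 0 1 (t j) else 1) i := by
          intro i
          by_cases hi : (i : ℕ) ∈ s <;> simp [hi]
        rw [Finset.prod_congr rfl fun i _ => h1 i, Fin.prod_univ_eq_prod_range
          (fun j : ℕ => if j ∈ s then gaussianReal 0 1 (t j) else 1) n,
          ← Finset.prod_filter]
        refine Finset.prod_congr ?_ fun _ _ => rfl
        ext i
        simp [and_comm]
      · refine Finset.prod_congr rfl fun i hi => ?_
        have hi' := (Finset.mem_filter.1 hi).2
        have e : n + (i - n) = i := by omega
        rw [e]
    · intro i hi j hj hij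
      have hi' := (Finset.mem_filter.1 hi).2
      have hj' := (Finset.mem_filter.1 hj).2
      simp only at hij
      omega
  calc gaussInf.map (split n) = (((gaussN n).prod gaussInf).map glue).map (split n) := by rw [key]
    _ = (gaussN n).prod gaussInf := by
      rw [Measure.map_map (measurable_split n) hg, hsg, Measure.map_id]

/-! ### Elementary tensors and the operators `S ⊗ I_n` -/

lemma memLp_tensor (n : ℕ) (f : Lp ℂ 2 (gaussN n)) (g : Lp ℂ 2 gaussInf) :
    MemLp (fun x : ℕ → ℝ => f (split n x).1 * g (split n x).2) 2 gaussInf := by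
  have h : MemLp (fun p : (Fin n → ℝ) × (ℕ → ℝ) => f p.1 * g p.2) 2
      ((gaussN n).prod gaussInf) := by
    have hm : AEStronglyMeasurable (fun p : (Fin n → ℝ) × (ℕ → ℝ) => f p.1 * g p.2)
        ((gaussN n).prod gaussInf) :=
      (Lp.aestronglyMeasurable f).comp_fst.mul (Lp.aestronglyMeasurable g).comp_snd
    rw [memLp_two_iff_integrable_sq_norm hm]
    have hf := (memLp_two_iff_integrable_sq_norm (Lp.aestronglyMeasurable f)).1 (Lp.memLp f)
    have hg := (memLp_two_iff_integrable_sq_norm (Lp.aestronglyMeasurable g)).1 (Lp.memLp g)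
    simpa only [norm_mul, mul_pow] using hf.mul_prod hg
  exact h.comp_measurePreserving (measurePreserving_split n)

/-- The elementary tensor `f ⊗ g`, for `f` in `L²` of `ℝⁿ` and `g` in `L²` of the remaining
coordinates, as an element of `L²` of `ℝ^∞`:
`(f ⊗ g)(x) = f(x₁, …, xₙ) g(xₙ₊₁, xₙ₊₂, …)`. -/
def tensor (n : ℕ) (f : Lp ℂ 2 (gaussN n)) (g : Lp ℂ 2 gaussInf) : Lp ℂ 2 gaussInf :=
  (memLp_tensor n f g).toLp

/-- `T` is the operator `S ⊗ I_n` on `L²` of `ℝ^∞`, identified with the Hilbert space tensor product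
of `L²` of `ℝⁿ` and `L²` of the remaining coordinates: the one and only bounded operator
with `T (f ⊗ g) = (S f) ⊗ g` for all `f` and `g`. -/
def IsTensorId (n : ℕ) (S : Lp ℂ 2 (gaussN n) →L[ℂ] Lp ℂ 2 (gaussN n))
    (T : Lp ℂ 2 gaussInf →L[ℂ] Lp ℂ 2 gaussInf) : Prop :=
  (∀ f g, T (tensor n f g) = tensor n (S f) g) ∧
    ∀ T' : Lp ℂ 2 gaussInf →L[ℂ] Lp ℂ 2 gaussInf,
      (∀ f g, T' (tensor n f g) = tensor n (S f) g) → T' = T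

/-! ### Transformations induced by matrices -/

/-- The transformation of `ℝ^∞` induced by an infinite matrix (with convergent row series). -/
def inducedMap (a : ℕ → ℕ → ℝ) (x : ℕ → ℝ) : ℕ → ℝ := fun i => ∑' j, a i j * x j

/-- The `n × n` truncation of an infinite matrix. -/
def trunc (a : ℕ → ℕ → ℝ) (n : ℕ) : Matrix (Fin n) (Fin n) ℝ := Matrix.of fun i j => a i j

/-- The linear transformation of `ℝⁿ` induced by the `n × n` truncation of an infinite matrix. -/
def truncMap (a : ℕ → ℕ → ℝ) (n : ℕ) (x : Fin n → ℝ) : Fin n → ℝ := (trunc a n).mulVec x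

end GaussComp

end

noncomputable section

namespace GaussComp

open scoped ENNReal symmDiff

/-! ### Composition operators and comparison of measures -/

section General

variable {X : Type*} [m : MeasurableSpace X] {μ : Measure X} {A : X → X}

/-! Everything rests on one inequality, `μ.map A ≤ c • μ` with `c` finite: it makes `A` nonsingular
and bounds `C_A` by `√c` on all of `L²`. In finite dimension the Gaussian density is a decreasing
function of the Euclidean norm, so a contraction does not decrease it; the linear change of
variables then gives the inequality with `c = |det A_n|⁻¹` (`map_mulVec_gaussN_le`). The lower bound
on the determinants makes `c` independent of `n`. Letting `A_n` act as the identity on the other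
coordinates keeps the constant, and the resulting composition operator is `C_{A_n} ⊗ I_n`. Since
rows are finite, the preimage of a given cylinder under `A` equals that under the extended `A_n` for
all large `n` (`eventually_extend_preimage_eq`). Hence the inequality holds for `A` on cylinders,
and by approximation on all measurable sets. The same fact makes `(C_{A_n} ⊗ I_n) f` eventually
equal to `C_A f` when `f` is the indicator of a cylinder. These indicators span a dense subspace,
and the uniform norm bound extends the convergence to `L²`. -/

lemma quasiMeasurePreserving_of_map_le {c : ℝ≥0∞} (hA : Measurable A) (h : μ.map A ≤ c • μ) :
    Measure.QuasiMeasurePreserving A μ μ :=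
  ⟨hA, Measure.absolutelyContinuous_of_le_smul h⟩

lemma memLp_comp_of_map_le {c : ℝ≥0∞} (hc : c ≠ ∞) (hA : Measurable A) (h : μ.map A ≤ c • μ)
    (f : Lp ℂ 2 μ) : MemLp (f ∘ A) 2 μ :=
  ((Lp.memLp f).of_measure_le_smul hc h).comp_of_map hA.aemeasurable

lemma norm_toLp_comp_le {c : ℝ≥0∞} (hc : c ≠ ∞) (hA : Measurable A) (h : μ.map A ≤ c • μ)
    (f : Lp ℂ 2 μ) :
    ‖(memLp_comp_of_map_le hc hA h f).toLp (f ∘ A)‖ ≤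
      (c ^ (1 / (2 : ℝ≥0∞)).toReal).toReal * ‖f‖ := by
  have hm := ((Lp.memLp f).of_measure_le_smul hc h).aestronglyMeasurable
  rw [Lp.norm_toLp, Lp.norm_def, ← eLpNorm_map_measure hm hA.aemeasurable, ← ENNReal.toReal_mul]
  refine ENNReal.toReal_mono ?_ ?_
  · exact ENNReal.mul_ne_top (by simp [hc]) (Lp.eLpNorm_ne_top f)
  · exact eLpNorm_le_of_measure_le_smul h

/-- A transformation whose image measure is dominated by a multiple of `μ` induces a bounded
composition operator. -/
lemma exists_isBoundedCompOp {c : ℝ≥0∞} (hc : c ≠ ∞) (hA : Measurable A) (h : μ.map A ≤ c • μ) :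
    ∃ C : Lp ℂ 2 μ →L[ℂ] Lp ℂ 2 μ, IsBoundedCompOp μ A C ∧ (∀ f, C f =ᵐ[μ] f ∘ A) ∧
      ‖C‖ ≤ (c ^ (1 / (2 : ℝ≥0∞)).toReal).toReal := by
  have hq := quasiMeasurePreserving_of_map_le hA h
  have hd : ∀ f : Lp ℂ 2 μ, f ∈ (compOp μ A hq).domain := memLp_comp_of_map_le hc hA h
  let L : Lp ℂ 2 μ →ₗ[ℂ] Lp ℂ 2 μ :=
    (compOp μ A hq).toFun ∘ₗ LinearMap.id.codRestrict (compOp μ A hq).domain hd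
  have hL : ∀ f, L f = (memLp_comp_of_map_le hc hA h f).toLp (f ∘ A) := fun f => rfl
  have hbound : ∀ f, ‖L f‖ ≤ (c ^ (1 / (2 : ℝ≥0∞)).toReal).toReal * ‖f‖ :=
    fun f => norm_toLp_comp_le hc hA h f
  refine ⟨L.mkContinuous _ hbound, ⟨hq, ?_⟩, fun f => ?_,
    L.mkContinuous_norm_le ENNReal.toReal_nonneg _⟩
  · refine LinearPMap.ext (by ext f; simpa using hd f) fun x _ _ => rfl
  · rw [LinearMap.mkContinuous_apply, hL]
    exact MemLp.coeFn_toLp _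

/-- Reduces the comparison of two composition operators on indicators to an equality of preimages.
-/
lemma indicatorConstLp_comp [IsFiniteMeasure μ] {C : Lp ℂ 2 μ →L[ℂ] Lp ℂ 2 μ}
    (hq : Measure.QuasiMeasurePreserving A μ μ) (hC : ∀ f, C f =ᵐ[μ] f ∘ A)
    {s : Set X} (hs : MeasurableSet s) :
    C (indicatorConstLp 2 hs (measure_ne_top μ s) (1 : ℂ)) =
      indicatorConstLp 2 (hq.measurable hs) (measure_ne_top μ _) (1 : ℂ) := by
  refine Lp.ext ?_
  refine (hC _).trans ((hq.ae_eq_comp indicatorConstLp_coeFn).trans ?_)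
  exact (indicatorConstLp_coeFn (μ := μ)).symm

/-- A closed subspace of `L²` containing the indicators of a generating `π`-system that contains
the whole space is everything. -/
lemma eq_top_of_indicatorConstLp_mem [IsFiniteMeasure μ]
    {S : Set (Set X)} (hgen : m = MeasurableSpace.generateFrom S) (hpi : IsPiSystem S)
    (V : Submodule ℂ (Lp ℂ 2 μ)) (hV : IsClosed (V : Set (Lp ℂ 2 μ)))
    (huniv : indicatorConstLp 2 MeasurableSet.univ (measure_ne_top μ _) (1 : ℂ) ∈ V)
    (hS : ∀ s (hs : MeasurableSet s), s ∈ S →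
      indicatorConstLp 2 hs (measure_ne_top μ s) (1 : ℂ) ∈ V) (f : Lp ℂ 2 μ) : f ∈ V := by
  have key : ∀ s (hs : MeasurableSet s),
      indicatorConstLp 2 hs (measure_ne_top μ s) (1 : ℂ) ∈ V := by
    refine MeasurableSpace.induction_on_inter hgen hpi ?_ ?_ ?_ ?_
    · rw [indicatorConstLp_empty]; exact V.zero_mem
    · exact fun t ht => hS t _ ht
    · intro t ht h
      have e : indicatorConstLp 2 ht.compl (measure_ne_top μ _) (1 : ℂ) =
          indicatorConstLp 2 MeasurableSet.univ (measure_ne_top μ _) (1 : ℂ) -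
            indicatorConstLp 2 ht (measure_ne_top μ t) (1 : ℂ) := by
        rw [eq_sub_iff_add_eq, ← indicatorConstLp_disjoint_union _ _ _ _
          disjoint_compl_left]
        congr 1
        simp
      rw [e]
      exact V.sub_mem huniv h
    -- Countable disjoint unions: finite unions are handled by additivity, and continuity from below
    -- gives convergence of their indicators in `L²`, where `V` is closed.
    · intro g hd hg h
      have hU : ∀ n, MeasurableSet (Set.accumulate g n) := fun n =>
        MeasurableSet.biUnion (Set.to_countable _) fun i _ => hg i
      have hmem : ∀ n, indicatorConstLp 2 (hU n) (measure_ne_top μ _) (1 : ℂ) ∈ V := by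
        intro n
        induction n with
        | zero =>
          have := h 0
          convert this using 2
          simp
        | succ n ih =>
          have hdis : Disjoint (Set.accumulate g n) (g (n + 1)) := by
            rw [Set.accumulate_def, Set.disjoint_iUnion₂_left]
            intro i hi
            exact hd (by omega)
          have e := indicatorConstLp_disjoint_union (p := 2) (hU n) (hg (n + 1))
            (measure_ne_top μ _) (measure_ne_top μ _) hdis (1 : ℂ)
          have := V.add_mem ih (h (n + 1))
          rw [← e] at this
          convert this using 2
          exact Set.accumulate_succ g n
      refine hV.mem_of_tendsto (b := atTop) ?_ (Eventually.of_forall hmem)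
      refine tendsto_indicatorConstLp_set (by norm_num) ?_
      have h1 : ∀ n, Set.accumulate g n ∆ (⋃ i, g i) = (⋃ i, g i) \ Set.accumulate g n :=
        fun n => symmDiff_of_le (Set.accumulate_subset_iUnion n)
      simp_rw [h1]
      have h2 : ∀ n, μ ((⋃ i, g i) \ Set.accumulate g n) =
          μ (⋃ i, g i) - μ (Set.accumulate g n) := fun n =>
        measure_sdiff (Set.accumulate_subset_iUnion n) (hU n).nullMeasurableSet
          (measure_ne_top μ _)
      simp_rw [h2]
      have := ENNReal.Tendsto.sub (tendsto_const_nhds (x := μ (⋃ i, g i)) (f := atTop))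
        (tendsto_measure_iUnion_accumulate (μ := μ) (f := g)) (Or.inl (measure_ne_top μ _))
      rwa [tsub_self] at this
  refine Lp.induction (by norm_num) (motive := fun f => f ∈ V) ?_ ?_ hV f
  · intro c s hs hμs
    have e : ((Lp.simpleFunc.indicatorConst 2 hs hμs.ne c : Lp.simpleFunc ℂ 2 μ) : Lp ℂ 2 μ) =
        c • indicatorConstLp 2 hs (measure_ne_top μ s) (1 : ℂ) := by
      rw [Lp.simpleFunc.coe_indicatorConst, indicatorConstLp, indicatorConstLp,
        ← MemLp.toLp_const_smul]
      refine MemLp.toLp_congr _ _ (Eventually.of_forall fun x => ?_)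
      by_cases hx : x ∈ s <;> simp [hx]
    rw [e]
    exact V.smul_mem _ (key s hs)
  · intro f g hf hg _ h1 h2
    exact V.add_mem h1 h2

/-- An inequality between finite measures holds if it holds on a generating algebra of sets. -/
lemma le_smul_of_isSetAlgebra {μ ν : Measure X} [IsFiniteMeasure μ]
    [IsFiniteMeasure ν] {c : ℝ≥0∞} (hc : c ≠ ∞) {S : Set (Set X)} (hS : IsSetAlgebra S)
    (hgen : m = MeasurableSpace.generateFrom S) (h : ∀ s ∈ S, ν s ≤ c * μ s) : ν ≤ c • μ := by
  refine Measure.le_iff.2 fun s hs => ?_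
  rw [Measure.smul_apply, smul_eq_mul]
  have happ : ∀ ε : ℝ, 0 < ε → ν s ≤ c * (μ s + ENNReal.ofReal ε) + ENNReal.ofReal ε := by
    intro ε hε
    -- Approximating with respect to `μ + ν` makes the symmetric difference small for both measures
    -- at once.
    obtain ⟨t, ht, hst⟩ := (Measure.MeasureDense.of_generateFrom_isSetAlgebra_finite (μ + ν) hS
      hgen).approx s hs (measure_ne_top _ _) ε hε
    rw [Measure.add_apply] at hst
    have hsub : s ⊆ t ∪ s ∆ t := fun x hx => by
      by_cases hxt : x ∈ t
      · exact Or.inl hxt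
      · exact Or.inr (Or.inl ⟨hx, hxt⟩)
    have hsub' : t ⊆ s ∪ s ∆ t := fun x hx => by
      by_cases hxs : x ∈ s
      · exact Or.inl hxs
      · exact Or.inr (Or.inr ⟨hx, hxs⟩)
    calc ν s ≤ ν t + ν (s ∆ t) := (measure_mono hsub).trans (measure_union_le _ _)
      _ ≤ c * μ t + ENNReal.ofReal ε := add_le_add (h t ht) (le_add_self.trans hst.le)
      _ ≤ c * (μ s + μ (s ∆ t)) + ENNReal.ofReal ε := by
        gcongr; exact (measure_mono hsub').trans (measure_union_le _ _)
      _ ≤ c * (μ s + ENNReal.ofReal ε) + ENNReal.ofReal ε := by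
        gcongr; exact le_self_add.trans hst.le
  have hlim : Tendsto (fun ε : ℝ => c * (μ s + ENNReal.ofReal ε) + ENNReal.ofReal ε) (𝓝[>] 0)
      (𝓝 (c * (μ s + ENNReal.ofReal 0) + ENNReal.ofReal 0)) := by
    have h0 : Tendsto (fun ε : ℝ => ENNReal.ofReal ε) (𝓝[>] 0) (𝓝 (ENNReal.ofReal 0)) :=
      (ENNReal.continuous_ofReal.tendsto 0).mono_left nhdsWithin_le_nhds
    exact (ENNReal.Tendsto.const_mul (tendsto_const_nhds.add h0) (Or.inr hc)).add h0
  rw [ENNReal.ofReal_zero, add_zero, add_zero] at hlim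
  exact ge_of_tendsto hlim (eventually_mem_nhdsWithin.mono happ)

end General

/-! ### The Gaussian estimate in finite dimension -/

/-- The density of the standard gaussian measure on `ℝⁿ`. -/
lemma gaussN_eq_withDensity (n : ℕ) :
    gaussN n = volume.withDensity fun x => ENNReal.ofReal (∏ i, gaussianPDFReal 0 1 (x i)) := by
  refine (Measure.pi_eq fun s hs => ?_)
  rw [withDensity_apply _ (MeasurableSet.univ_pi hs), volume_pi, Measure.restrict_pi_pi,
    ← ofReal_integral_eq_lintegral_ofReal]
  · rw [integral_fintype_prod_eq_prod, ENNReal.ofReal_prod_of_nonneg]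
    · exact Finset.prod_congr rfl fun i _ =>
        (gaussianReal_apply_eq_integral 0 one_ne_zero (s i)).symm
    · exact fun i _ => integral_nonneg fun x => gaussianPDFReal_nonneg 0 1 x
  · exact Integrable.fintype_prod fun i => (integrable_gaussianPDFReal 0 1).restrict
  · exact Eventually.of_forall fun x => Finset.prod_nonneg fun i _ => gaussianPDFReal_nonneg 0 1 _

lemma sum_sq_mulVec_le {n : ℕ} {M : Matrix (Fin n) (Fin n) ℝ}
    (hM : ‖Matrix.toEuclideanCLM (n := Fin n) (𝕜 := ℝ) M‖ ≤ 1) (x : Fin n → ℝ) :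
    ∑ i, (M.mulVec x) i ^ 2 ≤ ∑ i, x i ^ 2 := by
  have h := ContinuousLinearMap.le_of_opNorm_le _ hM (WithLp.toLp 2 x)
  rw [one_mul, Matrix.toEuclideanCLM_toLp, ← sq_le_sq₀ (norm_nonneg _) (norm_nonneg _),
    EuclideanSpace.real_norm_sq_eq, EuclideanSpace.real_norm_sq_eq] at h
  exact h

/-- The product density is a constant times `exp (-|x|² / 2)`, hence decreasing in the Euclidean
norm. -/
lemma prod_gaussianPDFReal_le {n : ℕ} {x y : Fin n → ℝ} (h : ∑ i, y i ^ 2 ≤ ∑ i, x i ^ 2) :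
    ∏ i, gaussianPDFReal 0 1 (x i) ≤ ∏ i, gaussianPDFReal 0 1 (y i) := by
  simp only [gaussianPDFReal, Finset.prod_mul_distrib, ← Real.exp_sum, sub_zero,
    ← Finset.sum_div, Finset.sum_neg_distrib]
  gcongr

/-- The image of the standard gaussian measure under an invertible linear contraction. -/
lemma map_mulVec_gaussN_le {n : ℕ} {M : Matrix (Fin n) (Fin n) ℝ} (hdet : M.det ≠ 0)
    (hM : ‖Matrix.toEuclideanCLM (n := Fin n) (𝕜 := ℝ) M‖ ≤ 1) :
    (gaussN n).map M.mulVec ≤ ENNReal.ofReal |M.det⁻¹| • gaussN n := by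
  have hmeas : Measurable M.mulVec :=
    (LinearMap.continuous_on_pi (Matrix.toLin' M)).measurable
  have hmap := Real.map_matrix_volume_pi_eq_smul_volume_pi hdet
  have hρ : Measurable fun x : Fin n → ℝ => ENNReal.ofReal (∏ i, gaussianPDFReal 0 1 (x i)) := by
    fun_prop
  refine Measure.le_iff.2 fun s hs => ?_
  rw [Measure.map_apply hmeas hs, Measure.smul_apply, gaussN_eq_withDensity,
    withDensity_apply _ (hmeas hs), withDensity_apply _ hs]
  calc ∫⁻ x in M.mulVec ⁻¹' s, ENNReal.ofReal (∏ i, gaussianPDFReal 0 1 (x i))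
      ≤ ∫⁻ x in M.mulVec ⁻¹' s, ENNReal.ofReal (∏ i, gaussianPDFReal 0 1 (M.mulVec x i)) :=
        lintegral_mono fun x =>
          ENNReal.ofReal_le_ofReal (prod_gaussianPDFReal_le (sum_sq_mulVec_le hM x))
    _ = ∫⁻ y in s, ENNReal.ofReal (∏ i, gaussianPDFReal 0 1 (y i)) ∂(volume.map M.mulVec) :=
        (setLIntegral_map hs hρ hmeas).symm
    _ = _ := by
        have e : (volume : Measure (Fin n → ℝ)).map M.mulVec =
            ENNReal.ofReal |M.det⁻¹| • volume := hmap
        rw [e, Measure.restrict_smul, lintegral_smul_measure]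

/-! ### Extension by the identity and elementary tensors -/

/-- The inverse of `split n`. -/
def glue (n : ℕ) (p : (Fin n → ℝ) × (ℕ → ℝ)) : ℕ → ℝ :=
  fun i => if h : i < n then p.1 ⟨i, h⟩ else p.2 (i - n)

lemma measurable_glue (n : ℕ) : Measurable (glue n) := by
  refine measurable_pi_lambda _ fun i => ?_
  by_cases h : i < n
  · simp only [glue, h, dif_pos]; fun_prop
  · simp only [glue, h, dif_neg, not_false_eq_true]; fun_prop

lemma glue_split (n : ℕ) (x : ℕ → ℝ) : glue n (split n x) = x := by
  ext i
  by_cases h : i < n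
  · simp [glue, split, h]
  · simp [glue, split, h, Nat.add_sub_cancel' (not_lt.1 h)]

lemma split_glue (n : ℕ) (p : (Fin n → ℝ) × (ℕ → ℝ)) : split n (glue n p) = p := by
  ext i <;> simp [split, glue]

lemma map_glue (n : ℕ) : ((gaussN n).prod gaussInf).map (glue n) = gaussInf := by
  rw [← (measurePreserving_split n).map_eq, Measure.map_map (measurable_glue n)
    (measurable_split n), show glue n ∘ split n = id from funext (glue_split n), Measure.map_id]

/-- The transformation of `ℝ^∞` acting as `B` on the first `n` coordinates and as the identity
on the remaining ones. -/
def extend (n : ℕ) (B : (Fin n → ℝ) → Fin n → ℝ) (x : ℕ → ℝ) : ℕ → ℝ :=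
  glue n (Prod.map B id (split n x))

lemma split_extend (n : ℕ) (B : (Fin n → ℝ) → Fin n → ℝ) (x : ℕ → ℝ) :
    split n (extend n B x) = (B (split n x).1, (split n x).2) :=
  split_glue n _

lemma measurable_extend {n : ℕ} {B : (Fin n → ℝ) → Fin n → ℝ} (hB : Measurable B) :
    Measurable (extend n B) :=
  (measurable_glue n).comp ((hB.prodMap measurable_id).comp (measurable_split n))

/-- Under the splitting the image measure is a product whose second factor is unchanged, so the
constant does not depend on the added coordinates. -/
lemma map_extend_le {n : ℕ} {B : (Fin n → ℝ) → Fin n → ℝ} (hB : Measurable B) {c : ℝ≥0∞}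
    (h : (gaussN n).map B ≤ c • gaussN n) :
    gaussInf.map (extend n B) ≤ c • gaussInf := by
  have hm : Measurable (Prod.map B (id : (ℕ → ℝ) → ℕ → ℝ)) := hB.prodMap measurable_id
  have e : extend n B = glue n ∘ Prod.map B id ∘ split n := rfl
  rw [e, ← Measure.map_map (measurable_glue n) (hm.comp (measurable_split n)),
    ← Measure.map_map hm (measurable_split n), (measurePreserving_split n).map_eq,
    ← Measure.map_prod_map _ _ hB measurable_id, Measure.map_id]
  have h1 : ((gaussN n).map B).prod gaussInf ≤ c • (gaussN n).prod gaussInf := by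
    rw [← Measure.prod_smul_left]
    exact Measure.prod_mono h le_rfl
  calc (((gaussN n).map B).prod gaussInf).map (glue n)
      ≤ (c • (gaussN n).prod gaussInf).map (glue n) := Measure.map_mono h1 (measurable_glue n)
    _ = c • gaussInf := by rw [Measure.map_smul, map_glue]

lemma tensor_indicatorConstLp (n : ℕ) {s : Set (Fin n → ℝ)} (hs : MeasurableSet s)
    {t : Set (ℕ → ℝ)} (ht : MeasurableSet t) :
    tensor n (indicatorConstLp 2 hs (measure_ne_top _ s) 1)
        (indicatorConstLp 2 ht (measure_ne_top _ t) 1) =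
      indicatorConstLp 2 (measurable_split n (hs.prod ht)) (measure_ne_top gaussInf _) (1 : ℂ) := by
  refine Lp.ext ((MemLp.coeFn_toLp _).trans (EventuallyEq.trans ?_ indicatorConstLp_coeFn.symm))
  have hq := (measurePreserving_split n).quasiMeasurePreserving
  have h1 := (Measure.quasiMeasurePreserving_fst.comp hq).ae_eq_comp
    (indicatorConstLp_coeFn (p := 2) (hs := hs) (hμs := measure_ne_top (gaussN n) s) (c := (1 : ℂ)))
  have h2 := (Measure.quasiMeasurePreserving_snd.comp hq).ae_eq_comp
    (indicatorConstLp_coeFn (p := 2) (hs := ht) (hμs := measure_ne_top gaussInf t) (c := (1 : ℂ)))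
  filter_upwards [h1, h2] with x hx1 hx2
  simp only [Function.comp_apply] at hx1 hx2
  rw [hx1, hx2]
  by_cases k1 : (split n x).1 ∈ s <;> by_cases k2 : (split n x).2 ∈ t <;>
    simp [Set.indicator, k1, k2]

/-- A bounded operator on `L²(ℝ^∞)` is determined by its values on elementary tensors. -/
lemma eq_of_tensor_eq (n : ℕ) {T T' : Lp ℂ 2 gaussInf →L[ℂ] Lp ℂ 2 gaussInf}
    (h : ∀ f g, T (tensor n f g) = T' (tensor n f g)) : T = T' := by
  let R : Set (Set ((Fin n → ℝ) × (ℕ → ℝ))) :=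
    Set.image2 (· ×ˢ ·) {s | MeasurableSet s} {t | MeasurableSet t}
  have hgen : (inferInstance : MeasurableSpace (ℕ → ℝ)) =
      MeasurableSpace.generateFrom {u | ∃ v ∈ R, split n ⁻¹' v = u} := by
    have : MeasurableSpace.generateFrom {u | ∃ v ∈ R, split n ⁻¹' v = u} =
        (MeasurableSpace.generateFrom R).comap (split n) := MeasurableSpace.comap_generateFrom.symm
    rw [this, generateFrom_prod]
    -- `split n` has the measurable left inverse `glue n`, so every measurable set is a preimage
    -- under `split n`.
    refine le_antisymm (fun E hE => ⟨glue n ⁻¹' E, measurable_glue n hE, ?_⟩)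
      (measurable_split n).comap_le
    rw [← Set.preimage_comp, show glue n ∘ split n = id from funext (glue_split n), Set.preimage_id]
  have hmem : ∀ s t (hs : MeasurableSet s) (ht : MeasurableSet t),
      indicatorConstLp 2 (measurable_split n (hs.prod ht)) (measure_ne_top gaussInf _) (1 : ℂ) ∈
        LinearMap.eqLocus T.toLinearMap T'.toLinearMap := fun s t hs ht => by
    rw [← tensor_indicatorConstLp n hs ht]
    exact h _ _
  refine ContinuousLinearMap.ext fun f => ?_
  refine eq_top_of_indicatorConstLp_mem hgen (isPiSystem_prod.comap (split n))
    (LinearMap.eqLocus T.toLinearMap T'.toLinearMap) (isClosed_eq T.continuous T'.continuous)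
    ?_ ?_ f
  · simpa using hmem Set.univ Set.univ MeasurableSet.univ MeasurableSet.univ
  · rintro _ hu ⟨_, ⟨s, hs, t, ht, rfl⟩, rfl⟩
    exact hmem s t hs ht

/-- The composition operator induced by `extend n B` is `C_B ⊗ I_n`. -/
lemma isTensorId_extend {n : ℕ} {B : (Fin n → ℝ) → Fin n → ℝ}
    {S : Lp ℂ 2 (gaussN n) →L[ℂ] Lp ℂ 2 (gaussN n)} {T : Lp ℂ 2 gaussInf →L[ℂ] Lp ℂ 2 gaussInf}
    (hS : ∀ f, S f =ᵐ[gaussN n] f ∘ B) (hT : ∀ f, T f =ᵐ[gaussInf] f ∘ extend n B)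
    (hq : Measure.QuasiMeasurePreserving (extend n B) gaussInf gaussInf) :
    IsTensorId n S T := by
  have h : ∀ f g, T (tensor n f g) = tensor n (S f) g := by
    intro f g
    refine Lp.ext ((hT _).trans (((hq.ae_eq_comp (MemLp.coeFn_toLp _))).trans
      (EventuallyEq.trans ?_ (MemLp.coeFn_toLp (memLp_tensor n (S f) g)).symm)))
    have h1 := (Measure.quasiMeasurePreserving_fst.comp
      (measurePreserving_split n).quasiMeasurePreserving).ae_eq_comp (hS f)
    filter_upwards [h1] with x hx
    simp only [Function.comp_apply] at hx ⊢
    rw [hx, split_extend]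
  exact ⟨h, fun T' hT' => eq_of_tensor_eq n fun f g => (hT' f g).trans (h f g).symm⟩

/-! ### Row-finite matrices and cylinders -/

lemma measurable_truncMap (a : ℕ → ℕ → ℝ) (n : ℕ) : Measurable (truncMap a n) :=
  (LinearMap.continuous_on_pi (Matrix.toLin' (trunc a n))).measurable

lemma inducedMap_apply {a : ℕ → ℕ → ℝ} {i K : ℕ} (hK : ∀ k, K ≤ k → a i k = 0) (x : ℕ → ℝ) :
    inducedMap a x i = ∑ j ∈ Finset.range K, a i j * x j := by
  refine tsum_eq_sum fun j hj => ?_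
  rw [hK j (by simpa using hj), zero_mul]

lemma measurable_inducedMap {a : ℕ → ℕ → ℝ} (hrow : ∀ j, ∃ K, ∀ k, K ≤ k → a j k = 0) :
    Measurable (inducedMap a) := by
  refine measurable_pi_lambda _ fun i => ?_
  obtain ⟨K, hK⟩ := hrow i
  simp_rw [inducedMap_apply hK]
  fun_prop

lemma extend_truncMap_apply {a : ℕ → ℕ → ℝ} {i K n : ℕ} (hK : ∀ k, K ≤ k → a i k = 0)
    (hKn : K ≤ n) (hin : i < n) (x : ℕ → ℝ) :
    extend n (truncMap a n) x i = inducedMap a x i := by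
  rw [inducedMap_apply fun k hk => hK k (hKn.trans hk), ← Fin.sum_univ_eq_sum_range]
  simp [extend, glue, hin, truncMap, trunc, split, Matrix.mulVec, dotProduct]

/-- On a cylinder, the transformation induced by a row-finite matrix is eventually given by the
finite truncations. -/
lemma eventually_extend_preimage_eq {a : ℕ → ℕ → ℝ} (hrow : ∀ j, ∃ K, ∀ k, K ≤ k → a j k = 0)
    {E : Set (ℕ → ℝ)} (hE : E ∈ measurableCylinders fun _ : ℕ => ℝ) :
    ∀ᶠ n in atTop, extend n (truncMap a n) ⁻¹' E = inducedMap a ⁻¹' E := by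
  obtain ⟨s, S, -, rfl⟩ := (mem_measurableCylinders _).1 hE
  choose K hK using hrow
  have hev : ∀ᶠ n in atTop, ∀ i ∈ s, K i ≤ n ∧ i < n :=
    (Finset.eventually_all s).2 fun i _ =>
      (eventually_ge_atTop (K i)).and (eventually_gt_atTop i)
  filter_upwards [hev] with n hn
  ext x
  simp only [Set.mem_preimage, mem_cylinder]
  have e : s.restrict (extend n (truncMap a n) x) = s.restrict (inducedMap a x) :=
    funext fun i => extend_truncMap_apply (hK i) (hn i i.2).1 (hn i i.2).2 x
  rw [e]

lemma map_inducedMap_le {a : ℕ → ℕ → ℝ} (hrow : ∀ j, ∃ K, ∀ k, K ≤ k → a j k = 0) {c : ℝ≥0∞}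
    (hc : c ≠ ∞) (h : ∀ n, gaussInf.map (extend n (truncMap a n)) ≤ c • gaussInf) :
    gaussInf.map (inducedMap a) ≤ c • gaussInf := by
  have hA := measurable_inducedMap hrow
  refine le_smul_of_isSetAlgebra hc isSetAlgebra_measurableCylinders
    generateFrom_measurableCylinders.symm fun E hE => ?_
  have hEm := MeasurableSet.of_mem_measurableCylinders hE
  -- The index `n` depends on `E`, which is harmless because `c` does not depend on `n`.
  obtain ⟨n, hn⟩ := (eventually_extend_preimage_eq hrow hE).exists
  rw [Measure.map_apply hA hEm, ← hn,
    ← Measure.map_apply (measurable_extend (measurable_truncMap a n)) hEm]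
  exact h n E

end GaussComp

end

/-! ### Uniform bounds and strong convergence -/

theorem corollary5p5 (a : ℕ → ℕ → ℝ)
    (hdet : ∃ ε : ℝ, 0 < ε ∧ ∀ n : ℕ, 1 ≤ n → ε ≤ |(GaussComp.trunc a n).det|)
    (hrow : ∀ j : ℕ, ∃ K : ℕ, ∀ k : ℕ, K ≤ k → a j k = 0)
    (hnorm : ∀ n : ℕ, 1 ≤ n →
      ‖Matrix.toEuclideanCLM (n := Fin n) (𝕜 := ℝ) (GaussComp.trunc a n)‖ ≤ 1) :
    ∃ (C : Lp ℂ 2 GaussComp.gaussInf →L[ℂ] Lp ℂ 2 GaussComp.gaussInf)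
      (Cn : ∀ n : ℕ, Lp ℂ 2 (GaussComp.gaussN n) →L[ℂ] Lp ℂ 2 (GaussComp.gaussN n))
      (T : ℕ → (Lp ℂ 2 GaussComp.gaussInf →L[ℂ] Lp ℂ 2 GaussComp.gaussInf)),
      GaussComp.IsBoundedCompOp GaussComp.gaussInf (GaussComp.inducedMap a) C ∧
      (∀ n : ℕ, GaussComp.IsBoundedCompOp (GaussComp.gaussN n) (GaussComp.truncMap a n) (Cn n)) ∧
      (∀ n : ℕ, GaussComp.IsTensorId n (Cn n) (T n)) ∧
      ∀ f : Lp ℂ 2 GaussComp.gaussInf, Tendsto (fun n => T n f) atTop (𝓝 (C f)) := by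
  open GaussComp in
  obtain ⟨ε, hε, hdet⟩ := hdet
  -- The minimum with `1` covers `n = 0`, where the empty determinant is `1`.
  have hδ : 0 < min ε 1 := lt_min hε one_pos
  have hdet' : ∀ n, min ε 1 ≤ |(trunc a n).det| := by
    rintro (_ | n)
    · simp
    · exact (min_le_left _ _).trans (hdet _ (by omega))
  have hnorm' : ∀ n, ‖Matrix.toEuclideanCLM (n := Fin n) (𝕜 := ℝ) (trunc a n)‖ ≤ 1 := by
    rintro (_ | n)
    · rw [Subsingleton.elim (trunc a 0) 0, map_zero, norm_zero]
      exact zero_le_one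
    · exact hnorm _ (by omega)
  have hc : ENNReal.ofReal (min ε 1)⁻¹ ≠ ⊤ := ENNReal.ofReal_ne_top
  have hmapN : ∀ n, (gaussN n).map (truncMap a n) ≤ ENNReal.ofReal (min ε 1)⁻¹ • gaussN n := by
    intro n
    refine (map_mulVec_gaussN_le (abs_pos.1 (hδ.trans_le (hdet' n))) (hnorm' n)).trans ?_
    have : ENNReal.ofReal |(trunc a n).det⁻¹| ≤ ENNReal.ofReal (min ε 1)⁻¹ := by
      rw [abs_inv]
      exact ENNReal.ofReal_le_ofReal (inv_anti₀ hδ (hdet' n))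
    exact Measure.le_iff.2 fun s _ => mul_le_mul_left this _
  have hmapE := fun n => map_extend_le (measurable_truncMap a n) (hmapN n)
  have hmapA := map_inducedMap_le hrow hc hmapE
  have hA := measurable_inducedMap hrow
  have hE := fun n => measurable_extend (measurable_truncMap a n)
  obtain ⟨C, hC, hCf, -⟩ := exists_isBoundedCompOp hc hA hmapA
  choose Cn hCn hCnf _ using fun n =>
    exists_isBoundedCompOp hc (measurable_truncMap a n) (hmapN n)
  choose T _ hTf hTnorm using fun n => exists_isBoundedCompOp hc (hE n) (hmapE n)
  have hqE := fun n => quasiMeasurePreserving_of_map_le (hE n) (hmapE n)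
  refine ⟨C, Cn, T, hC, hCn, fun n => isTensorId_extend (hCnf n) (hTf n) (hqE n), ?_⟩
  let V : Submodule ℂ (Lp ℂ 2 gaussInf) :=
    { carrier := {f | Tendsto (fun n => T n f) atTop (𝓝 (C f))}
      zero_mem' := by simp
      add_mem' := fun hf hg => by simpa using Tendsto.add hf hg
      smul_mem' := fun z f hf => by simpa using Tendsto.const_smul hf z }
  have hequi : Equicontinuous fun n => (T n : Lp ℂ 2 gaussInf → Lp ℂ 2 gaussInf) :=
    have hiff : (∃ M, ∀ n, ‖T n‖ ≤ M) ↔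
        Equicontinuous fun n => (T n : Lp ℂ 2 gaussInf → Lp ℂ 2 gaussInf) :=
      (NormedSpace.equicontinuous_TFAE T).out 5 1
    hiff.1 ⟨_, hTnorm⟩
  -- For an equicontinuous family and a continuous limit, the set of points of convergence is
  -- closed.
  have hVclosed : IsClosed (V : Set (Lp ℂ 2 gaussInf)) :=
    hequi.isClosed_setOfPred_tendsto C.continuous
  have hcyl : ∀ s (hs : MeasurableSet s), s ∈ measurableCylinders (fun _ : ℕ => ℝ) →
      indicatorConstLp 2 hs (measure_ne_top gaussInf s) (1 : ℂ) ∈ V := by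
    intro s hs hmem
    -- On a cylinder indicator the sequence is eventually constant.
    refine tendsto_const_nhds.congr' ?_
    filter_upwards [eventually_extend_preimage_eq hrow hmem] with n hn
    rw [indicatorConstLp_comp (hqE n) (hTf n),
      indicatorConstLp_comp (quasiMeasurePreserving_of_map_le hA hmapA) hCf]
    congr 1
    exact hn.symm
  exact eq_top_of_indicatorConstLp_mem generateFrom_measurableCylinders.symm
    isPiSystem_measurableCylinders V hVclosed
    (hcyl _ MeasurableSet.univ (univ_mem_measurableCylinders _)) hcyl
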